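/- Let $(\Omega,\mu)$ be a $\sigma$-finite measure space with $\sigma$-algebra $\Sigma(\Omega)$ and let $\mathcal H$ be a complex Hilbert space. Let $P:\Sigma(\Omega)\to\mathcal B(\mathcal H)$ be a projection-valued measure, i.e. every $P(S)$ is an orthogonal projection, $P(\varnothing)=0$, $P(\Omega)=1$, $P(S\cap S')=P(S)P(S')$, and $P(\bigcup_i S_i)=\sum_i P(S_i)$ (strong operator convergence) for pairwise disjoint $S_1,S_2,\dots\in\Sigma(\Omega)$. Assume that $P$ is absolutely continuous with respect to $\mu$, i.e. $\mu(S)=0$ implies $P(S)=0$. Let $\mathcal S_1^{\mathrm{sa}}(\mathcal H)$ be the real vector space of self-adjoint operators $\gamma$ with $\|\gamma\|_1:=\operatorname{Tr}|\gamma|<\infty$. For every $\gamma\in\mathcal S_1^{\mathrm{sa}}(\mathcal H)$ the map $S\mapsto\operatorname{Tr}(P(S)\gamma)$ is a (finite, real) signed measure that is absolutely continuous with respect to $\mu$. Let $D(\gamma)\in L^1_{\mathbb R}(\Omega,\mu)$ be its Radon–Nikodym derivative with respect to $\mu$. Then $D:\mathcal S_1^{\mathrm{sa}}(\mathcal H)\to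 L^1_{\mathbb R}(\Omega,\mu)$ is the unique linear map satisfying 1. $\|D(\gamma)\|_{1}\le\|\gamma\|_1$ for all $\gamma\in\mathcal S_1^{\mathrm{sa}}(\mathcal H)$, 2. $\gamma\ge 0\Rightarrow D(\gamma)\ge 0$ $\mu$-almost everywhere, 3. $\operatorname{Tr}(\gamma)=\int_\Omega D(\gamma)\,d\mu$ for all $\gamma\in\mathcal S_1^{\mathrm{sa}}(\mathcal H)$, 4. $\operatorname{Tr}(P(S)\gamma)=\int_S D(\gamma)\,d\mu$ for all $\gamma\in\mathcal S_1^{\mathrm{sa}}(\mathcal H)$ and $S\in\Sigma(\Omega)$. Moreover, if $P$ is faithful, meaning that $P(S)=0$ implies $\mu(S)=0$, then $D$ is surjective. -/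

import Mathlib

open MeasureTheory
open scoped InnerProductSpace ENNReal

namespace DiagonalMap

section TraceClass

variable {H : Type*} [NormedAddCommGroup H] [InnerProductSpace ℂ H] [CompleteSpace H]

variable (H) in
/-- A fixed Hilbert (orthonormal) basis of `H`; traces are computed in it. The trace of a
trace-class operator and the trace norm do not depend on the basis. -/
noncomputable def basis :
    HilbertBasis (Classical.choose (exists_hilbertBasis ℂ H) : Set H) ℂ H :=
  Classical.choose (Classical.choose_spec (exists_hilbertBasis ℂ H))

/-- The trace `Tr A = ∑ᵢ ⟨eᵢ, A eᵢ⟩`. -/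
noncomputable def trace (A : H →L[ℂ] H) : ℂ :=
  ∑' i, ⟪basis H i, A (basis H i)⟫_ℂ

/-- `A` is trace class: `Tr |A| < ∞`, where `|A| = (A† A)^(1/2)`. -/
def IsTraceClass (A : H →L[ℂ] H) : Prop :=
  Summable fun i => ⟪basis H i, CFC.abs A (basis H i)⟫_ℂ

/-- The trace norm `‖A‖₁ = Tr |A|`. -/
noncomputable def traceNorm (A : H →L[ℂ] H) : ℝ :=
  (trace (CFC.abs A)).re

/-- Parseval's identity. -/
theorem enorm_sq_eq_tsum (x : H) :
    ENNReal.ofReal (‖x‖ ^ 2) = ∑' j, ENNReal.ofReal (‖⟪basis H j, x⟫_ℂ‖ ^ 2) := by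
  have h := (basis H).hasSum_inner_mul_inner x x
  have h2 : HasSum (fun j => ‖⟪basis H j, x⟫_ℂ‖ ^ 2) (‖x‖ ^ 2) := by
    have h3 := Complex.hasSum_re h
    have e : (⟪x, x⟫_ℂ).re = ‖x‖ ^ 2 := (norm_sq_eq_re_inner (𝕜 := ℂ) x).symm
    rw [e] at h3
    refine h3.congr_fun ?_ |> fun h => h
    intro j
    rw [← inner_conj_symm x, RCLike.conj_mul]
    norm_cast
  rw [← h2.tsum_eq, ENNReal.ofReal_tsum_of_nonneg (fun _ => by positivity) h2.summable]

/-- The Hilbert-Schmidt norms of `T` and of its adjoint agree. -/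
theorem tsum_adjoint (T : H →L[ℂ] H) :
    ∑' i, ENNReal.ofReal (‖T (basis H i)‖ ^ 2) =
      ∑' i, ENNReal.ofReal (‖ContinuousLinearMap.adjoint T (basis H i)‖ ^ 2) := by
  have h : ∀ A : H →L[ℂ] H, ∑' i, ENNReal.ofReal (‖A (basis H i)‖ ^ 2) =
      ∑' i, ∑' j, ENNReal.ofReal (‖⟪basis H j, A (basis H i)⟫_ℂ‖ ^ 2) :=
    fun A => tsum_congr fun i => enorm_sq_eq_tsum _
  rw [h, h, ENNReal.tsum_comm]
  refine tsum_congr fun j => tsum_congr fun i => ?_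
  rw [ContinuousLinearMap.adjoint_inner_right, norm_inner_symm]

theorem tsum_comp_le (T Q : H →L[ℂ] H) (hQ : IsSelfAdjoint Q) (hQ1 : ‖Q‖ ≤ 1) :
    ∑' i, ENNReal.ofReal (‖T (Q (basis H i))‖ ^ 2) ≤
      ∑' i, ENNReal.ofReal (‖T (basis H i)‖ ^ 2) := by
  have h := tsum_adjoint (T * Q)
  simp only [mul_apply_eq_comp] at h
  rw [h, tsum_adjoint T]
  refine ENNReal.tsum_le_tsum fun i => ENNReal.ofReal_le_ofReal ?_
  have e : ContinuousLinearMap.adjoint (T * Q) = Q * ContinuousLinearMap.adjoint T := by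
    rw [← ContinuousLinearMap.star_eq_adjoint, star_mul, hQ.star_eq]; rfl
  rw [e]
  gcongr
  exact (Q.le_opNorm _).trans (mul_le_of_le_one_left (norm_nonneg _) hQ1)

theorem re_inner_eq_norm_sqrt (M : H →L[ℂ] H) (hM : 0 ≤ M) (x : H) :
    (⟪x, M x⟫_ℂ).re = ‖CFC.sqrt M x‖ ^ 2 := by
  have h1 : CFC.sqrt M * CFC.sqrt M = M := CFC.sqrt_mul_sqrt_self M hM
  have h2 : IsSelfAdjoint (CFC.sqrt M) := (CFC.sqrt_nonneg M).isSelfAdjoint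
  conv_lhs => rw [← h1]
  rw [mul_apply_eq_comp, ← ContinuousLinearMap.adjoint_inner_left,
    ← ContinuousLinearMap.star_eq_adjoint, h2.star_eq]
  exact (norm_sq_eq_re_inner (𝕜 := ℂ) _).symm

set_option linter.unusedSectionVars false in
theorem inner_eq_re (M : H →L[ℂ] H) (hM : 0 ≤ M) (x : H) :
    ⟪x, M x⟫_ℂ = ((⟪x, M x⟫_ℂ).re : ℂ) := by
  have h := ((ContinuousLinearMap.nonneg_iff_isPositive M).1 hM).inner_nonneg_right x
  exact (Complex.eq_re_of_ofReal_le (r := 0) (by simpa using h))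

theorem re_inner_nonneg (M : H →L[ℂ] H) (hM : 0 ≤ M) (x : H) : 0 ≤ (⟪x, M x⟫_ℂ).re := by
  rw [re_inner_eq_norm_sqrt M hM]; positivity

theorem re_inner_mono {A B : H →L[ℂ] H} (h : A ≤ B) (x : H) :
    (⟪x, A x⟫_ℂ).re ≤ (⟪x, B x⟫_ℂ).re := by
  have := re_inner_nonneg (B - A) (sub_nonneg.2 h) x
  simpa [inner_sub_right] using this

theorem summable_iff (M : H →L[ℂ] H) (hM : 0 ≤ M) :
    (Summable fun i => ⟪basis H i, M (basis H i)⟫_ℂ) ↔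
      Summable fun i => (⟪basis H i, M (basis H i)⟫_ℂ).re := by
  rw [← Complex.summable_ofReal]
  exact summable_congr fun i => inner_eq_re M hM _

/-- Cutting down by a self-adjoint contraction does not increase the trace. -/
theorem sum_conj_le (M Q : H →L[ℂ] H) (hM : 0 ≤ M) (hQ : IsSelfAdjoint Q) (hQ1 : ‖Q‖ ≤ 1)
    (hs : Summable fun i => (⟪basis H i, M (basis H i)⟫_ℂ).re) (s : Finset _) :
    ∑ i ∈ s, (⟪basis H i, (Q * M * Q) (basis H i)⟫_ℂ).re ≤
      ∑' i, (⟪basis H i, M (basis H i)⟫_ℂ).re := by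
  have e : ∀ x : H, (⟪x, (Q * M * Q) x⟫_ℂ).re = ‖CFC.sqrt M (Q x)‖ ^ 2 := by
    intro x
    rw [← re_inner_eq_norm_sqrt M hM]
    simp only [mul_apply_eq_comp]
    rw [← ContinuousLinearMap.adjoint_inner_left, ← ContinuousLinearMap.star_eq_adjoint,
      hQ.star_eq]
  simp_rw [e]
  have h := tsum_comp_le (CFC.sqrt M) Q hQ hQ1
  have hn : ∀ i, 0 ≤ (⟪basis H i, M (basis H i)⟫_ℂ).re := fun i => re_inner_nonneg M hM _
  simp_rw [← re_inner_eq_norm_sqrt M hM (basis H _)] at h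
  rw [← ENNReal.ofReal_tsum_of_nonneg hn hs] at h
  have h2 := (ENNReal.sum_le_tsum s).trans h
  rw [← ENNReal.ofReal_sum_of_nonneg (fun _ _ => by positivity)] at h2
  exact (ENNReal.ofReal_le_ofReal_iff (tsum_nonneg hn)).1 h2

/-- A self-adjoint operator dominated in both directions by a positive operator of finite trace
is trace class. -/
theorem isTraceClass_of_le (C M : H →L[ℂ] H) (hC : IsSelfAdjoint C) (hM : 0 ≤ M)
    (h1 : C ≤ M) (h2 : -C ≤ M)
    (hs : Summable fun i => (⟪basis H i, M (basis H i)⟫_ℂ).re) : IsTraceClass C := by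
  refine (summable_iff _ (CFC.abs_nonneg C)).2 ?_
  refine summable_of_sum_le (c := 2 * ∑' i, (⟪basis H i, M (basis H i)⟫_ℂ).re)
    (fun i => re_inner_nonneg _ (CFC.abs_nonneg C) _) fun s => ?_
  refine le_of_forall_pos_le_add fun δ hδ => ?_
  obtain ⟨ε, hε, hεδ⟩ : ∃ ε : ℝ, 0 < ε ∧ s.card * ε ≤ δ := by
    refine ⟨δ / (s.card + 1), by positivity, ?_⟩
    rw [mul_div_assoc', div_le_iff₀ (by positivity)]
    nlinarith
  let f : ℝ → ℝ := fun x => max 0 (min 1 (x / ε))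
  have hf : Continuous f := by fun_prop
  have hf1 : ∀ x, ‖f x‖ ≤ 1 := fun x => by
    rw [Real.norm_of_nonneg (le_max_left _ _)]
    exact max_le zero_le_one (min_le_left _ _)
  have hf' : Continuous fun x => f (-x) := hf.comp continuous_neg
  have key : CFC.abs C ≤ cfc f C * C * cfc f C +
      cfc (fun x => f (-x)) C * (-C) * cfc (fun x => f (-x)) C + ε • (1 : H →L[ℂ] H) := by
    have e1 : cfc f C * C * cfc f C = cfc (fun x : ℝ => f x * x * f x) C := by
      rw [cfc_mul (fun x => f x * x) f C (by fun_prop) (by fun_prop),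
        cfc_mul f (fun x => x) C (by fun_prop) (by fun_prop), cfc_id' ℝ C]
    have e2 : cfc (fun x => f (-x)) C * (-C) * cfc (fun x => f (-x)) C =
        cfc (fun x : ℝ => f (-x) * (-x) * f (-x)) C := by
      rw [cfc_mul (fun x => f (-x) * (-x)) (fun x => f (-x)) C (by fun_prop) (by fun_prop),
        cfc_mul (fun x => f (-x)) (fun x => -x) C (by fun_prop) (by fun_prop),
        show cfc (fun x : ℝ => -x) C = -C by rw [cfc_neg (fun x : ℝ => x) C, cfc_id' ℝ C]]
    have e3 : ε • (1 : H →L[ℂ] H) = cfc (fun _ : ℝ => ε) C := by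
      rw [cfc_const ε C, Algebra.algebraMap_eq_smul_one]
    rw [e1, e2, e3, ← cfc_add C (fun x : ℝ => f x * x * f x) (fun x => f (-x) * (-x) * f (-x))
      (by fun_prop) (by fun_prop), ← cfc_add C _ (fun _ : ℝ => ε) (by fun_prop) (by fun_prop),
      CFC.abs_eq_cfc_norm C]
    refine cfc_mono (fun x _ => ?_) (by fun_prop) (by fun_prop)
    rw [Real.norm_eq_abs]
    have fneg : ∀ y : ℝ, y ≤ 0 → f y = 0 := fun y hy =>
      max_eq_left ((min_le_right _ _).trans (div_nonpos_of_nonpos_of_nonneg hy hε.le))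
    have fbig : ∀ y : ℝ, ε ≤ y → f y = 1 := fun y hy => by
      have : 1 ≤ y / ε := (one_le_div hε).2 hy
      simp [f, min_eq_left this]
    have main : ∀ y : ℝ, 0 ≤ y → y ≤ f y * y * f y + ε := fun y hy => by
      rcases le_total ε y with h | h
      · rw [fbig y h]; linarith
      · have : 0 ≤ f y * y * f y := mul_nonneg (mul_nonneg (le_max_left _ _) hy) (le_max_left _ _)
        linarith
    rcases le_total 0 x with hx | hx
    · rw [abs_of_nonneg hx, fneg (-x) (by linarith)]
      linarith [main x hx]
    · rw [abs_of_nonpos hx, fneg x hx]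
      linarith [main (-x) (by linarith)]
  have sa1 : IsSelfAdjoint (cfc f C) := cfc_predicate f C
  have sa2 : IsSelfAdjoint (cfc (fun x => f (-x)) C) := cfc_predicate _ C
  have n1 : ‖cfc f C‖ ≤ 1 := norm_cfc_le zero_le_one fun x _ => hf1 x
  have n2 : ‖cfc (fun x => f (-x)) C‖ ≤ 1 := norm_cfc_le zero_le_one fun x _ => hf1 (-x)
  have key2 := key.trans (add_le_add_left (add_le_add (sa1.conjugate_le_conjugate h1)
    (sa2.conjugate_le_conjugate h2)) (ε • (1 : H →L[ℂ] H)))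
  have t1 := sum_conj_le M _ hM sa1 n1 hs s
  have t2 := sum_conj_le M _ hM sa2 n2 hs s
  have t3 := Finset.sum_le_sum fun i (_ : i ∈ s) => re_inner_mono key2 (basis H i)
  have t4 : ∀ i, (⟪basis H i, (ε • (1 : H →L[ℂ] H)) (basis H i)⟫_ℂ).re = ε := fun i => by
    have hb : ‖basis H i‖ = 1 := (basis H).orthonormal.1 i
    simp [inner_smul_right_eq_smul, hb]
  have t5 : ∀ (A B : H →L[ℂ] H) i,
      (⟪basis H i, (A + B + ε • (1 : H →L[ℂ] H)) (basis H i)⟫_ℂ).re =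
      (⟪basis H i, A (basis H i)⟫_ℂ).re + (⟪basis H i, B (basis H i)⟫_ℂ).re + ε := fun A B i => by
    rw [add_apply, inner_add_right, Complex.add_re, t4,
      add_apply, inner_add_right, Complex.add_re]
  simp_rw [t5] at t3
  rw [Finset.sum_add_distrib, Finset.sum_add_distrib, Finset.sum_const, nsmul_eq_mul] at t3
  linarith

theorem IsTraceClass.summable_re {A : H →L[ℂ] H} (hA : IsTraceClass A) :
    Summable fun i => (⟪basis H i, CFC.abs A (basis H i)⟫_ℂ).re :=
  (summable_iff _ (CFC.abs_nonneg A)).1 hA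

theorem le_abs {A : H →L[ℂ] H} (hA : IsSelfAdjoint A) : A ≤ CFC.abs A := by
  rw [← sub_nonneg, CFC.abs_sub_self A]
  exact nsmul_nonneg (CFC.negPart_nonneg A) 2

theorem neg_le_abs {A : H →L[ℂ] H} (hA : IsSelfAdjoint A) : -A ≤ CFC.abs A := by
  rw [← CFC.abs_neg A]; exact le_abs hA.neg

variable (H) in
/-- The real vector space of self-adjoint trace-class operators on `H`. -/
def selfAdjointTraceClass : Submodule ℝ (H →L[ℂ] H) where
  carrier := {γ | IsSelfAdjoint γ ∧ IsTraceClass γ}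
  zero_mem' := ⟨.zero _, by simp [IsTraceClass]⟩
  add_mem' := by
    rintro A B ⟨hA, hA'⟩ ⟨hB, hB'⟩
    refine ⟨hA.add hB, isTraceClass_of_le _ (CFC.abs A + CFC.abs B) (hA.add hB)
      (add_nonneg (CFC.abs_nonneg A) (CFC.abs_nonneg B)) (add_le_add (le_abs hA) (le_abs hB))
      ?_ ?_⟩
    · rw [neg_add]; exact add_le_add (neg_le_abs hA) (neg_le_abs hB)
    · simpa [inner_add_right] using hA'.summable_re.add hB'.summable_re
  smul_mem' := by
    rintro c A ⟨hA, hA'⟩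
    refine ⟨(IsSelfAdjoint.all c).smul hA, ?_⟩
    have e : CFC.abs (c • A) = ‖c‖ • CFC.abs A := CFC.abs_smul c A
    have h := hA'.mul_left ((‖c‖ : ℝ) : ℂ)
    unfold IsTraceClass
    rw [e]
    simpa [inner_smul_right_eq_smul] using h

end TraceClass

/-- A projection-valued measure on the measurable space `Ω`, with values in the orthogonal
projections of `H`; the series in the countable additivity converges in the strong operator
topology. Only the values on measurable sets matter. -/
structure ProjectionValuedMeasure (Ω H : Type*) [MeasurableSpace Ω] [NormedAddCommGroup H]
    [InnerProductSpace ℂ H] [CompleteSpace H] where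
  toFun : Set Ω → H →L[ℂ] H
  isStarProjection : ∀ S, MeasurableSet S → IsStarProjection (toFun S)
  empty : toFun ∅ = 0
  univ : toFun Set.univ = 1
  hasSum_iUnion : ∀ S : ℕ → Set Ω, (∀ i, MeasurableSet (S i)) →
    Pairwise (fun i j => Disjoint (S i) (S j)) →
    ∀ x : H, HasSum (fun i => toFun (S i) x) (toFun (⋃ i, S i) x)
  inter : ∀ S S', MeasurableSet S → MeasurableSet S' → toFun (S ∩ S') = toFun S * toFun S'

section Diagonal

variable {Ω H : Type*} [MeasurableSpace Ω] [NormedAddCommGroup H] [InnerProductSpace ℂ H]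
  [CompleteSpace H]

/-- `P` vanishes on the `μ`-null sets. -/
def ProjectionValuedMeasure.AbsolutelyContinuous (P : ProjectionValuedMeasure Ω H)
    (μ : Measure Ω) : Prop :=
  ∀ S, MeasurableSet S → μ S = 0 → P.toFun S = 0

/-- `P` is faithful: `P(S) = 0` implies `μ(S) = 0`. -/
def ProjectionValuedMeasure.Faithful (P : ProjectionValuedMeasure Ω H)
    (μ : Measure Ω) : Prop :=
  ∀ S, MeasurableSet S → P.toFun S = 0 → μ S = 0

/-- `ρ` is the Radon-Nikodym derivative with respect to `μ` of the signed measure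
`S ↦ Tr(P(S)γ)`: this set function is a (real-valued, countably additive) signed measure, it is
absolutely continuous with respect to `μ`, and `ρ` is its derivative. -/
def IsRadonNikodymDerivative (P : ProjectionValuedMeasure Ω H) (μ : Measure Ω)
    (γ : H →L[ℂ] H) (ρ : Lp ℝ 1 μ) : Prop :=
  ∃ ν : SignedMeasure Ω,
    (∀ S, MeasurableSet S → ((ν S : ℝ) : ℂ) = trace (P.toFun S * γ)) ∧
    VectorMeasure.AbsolutelyContinuous ν μ.toENNRealVectorMeasure ∧
    ρ =ᵐ[μ] ν.rnDeriv μ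

/-- The four characteristic properties of the diagonal map. -/
structure IsDiagonalMap (P : ProjectionValuedMeasure Ω H) (μ : Measure Ω)
    (D : selfAdjointTraceClass H →ₗ[ℝ] Lp ℝ 1 μ) : Prop where
  norm_le : ∀ γ : selfAdjointTraceClass H, ‖D γ‖ ≤ traceNorm (γ : H →L[ℂ] H)
  nonneg : ∀ γ : selfAdjointTraceClass H, (γ : H →L[ℂ] H).IsPositive → 0 ≤ᵐ[μ] D γ
  trace_eq : ∀ γ : selfAdjointTraceClass H,
    trace (γ : H →L[ℂ] H) = ((∫ x, D γ x ∂μ : ℝ) : ℂ)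
  trace_mul_eq : ∀ γ : selfAdjointTraceClass H, ∀ S, MeasurableSet S →
    trace (P.toFun S * (γ : H →L[ℂ] H)) = ((∫ x in S, D γ x ∂μ : ℝ) : ℂ)

end Diagonal

end DiagonalMap

namespace DiagonalMap

section Trace

variable {H : Type*} [NormedAddCommGroup H] [InnerProductSpace ℂ H] [CompleteSpace H]

/-- The square of the Hilbert-Schmidt norm. -/
noncomputable def hilbertSchmidtSq (T : H →L[ℂ] H) : ℝ≥0∞ :=
  ∑' i, ENNReal.ofReal (‖T (basis H i)‖ ^ 2)

theorem hilbertSchmidtSq_mul_le (Q T : H →L[ℂ] H) (hQ : ‖Q‖ ≤ 1) :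
    hilbertSchmidtSq (Q * T) ≤ hilbertSchmidtSq T := by
  refine ENNReal.tsum_le_tsum fun i => ENNReal.ofReal_le_ofReal ?_
  gcongr
  exact (Q.le_opNorm _).trans (mul_le_of_le_one_left (norm_nonneg _) hQ)

theorem summable_norm_inner_sq {T : H →L[ℂ] H} (hT : hilbertSchmidtSq T ≠ ⊤) :
    Summable fun p : ((Classical.choose (exists_hilbertBasis ℂ H) : Set H) ×
      (Classical.choose (exists_hilbertBasis ℂ H) : Set H)) =>
        ‖⟪basis H p.2, T (basis H p.1)⟫_ℂ‖ ^ 2 := by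
  have h : ∑' p : ((Classical.choose (exists_hilbertBasis ℂ H) : Set H) ×
      (Classical.choose (exists_hilbertBasis ℂ H) : Set H)),
        ENNReal.ofReal (‖⟪basis H p.2, T (basis H p.1)⟫_ℂ‖ ^ 2) ≠ ⊤ := by
    rw [ENNReal.tsum_prod']
    simp_rw [← enorm_sq_eq_tsum]
    exact hT
  refine (ENNReal.summable_toReal h).congr fun p => ?_
  rw [ENNReal.toReal_ofReal (by positivity)]

/-- The trace of a product of two Hilbert-Schmidt operators is cyclic. -/
theorem exists_hasSum_inner_mul_comm {A B : H →L[ℂ] H} (hA : hilbertSchmidtSq A ≠ ⊤)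
    (hB : hilbertSchmidtSq B ≠ ⊤) :
    ∃ s, HasSum (fun i => ⟪basis H i, (A * B) (basis H i)⟫_ℂ) s ∧
      HasSum (fun i => ⟪basis H i, (B * A) (basis H i)⟫_ℂ) s := by
  have expand : ∀ (C D : H →L[ℂ] H) i,
      HasSum (fun j => ⟪basis H i, C (basis H j)⟫_ℂ * ⟪basis H j, D (basis H i)⟫_ℂ)
        ⟪basis H i, (C * D) (basis H i)⟫_ℂ := fun C D i => by
    have h := (basis H).hasSum_inner_mul_inner
      (ContinuousLinearMap.adjoint C (basis H i)) (D (basis H i))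
    simp only [ContinuousLinearMap.adjoint_inner_left] at h
    exact h
  let F : ((Classical.choose (exists_hilbertBasis ℂ H) : Set H) ×
      (Classical.choose (exists_hilbertBasis ℂ H) : Set H)) → ℂ := fun p =>
    ⟪basis H p.1, A (basis H p.2)⟫_ℂ * ⟪basis H p.2, B (basis H p.1)⟫_ℂ
  have hF : Summable F := by
    refine .of_norm_bounded (((summable_norm_inner_sq hA).prod_symm).add
      (summable_norm_inner_sq hB)) fun p => ?_
    simp only [F, norm_mul, Prod.fst_swap, Prod.snd_swap]
    nlinarith [sq_nonneg (‖⟪basis H p.1, A (basis H p.2)⟫_ℂ‖ - ‖⟪basis H p.2, B (basis H p.1)⟫_ℂ‖),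
      sq_nonneg (‖⟪basis H p.1, A (basis H p.2)⟫_ℂ‖ + ‖⟪basis H p.2, B (basis H p.1)⟫_ℂ‖)]
  refine ⟨∑' p, F p, hF.hasSum.prod_fiberwise fun i => expand A B i, ?_⟩
  refine ((Equiv.prodComm _ _).hasSum_iff.2 hF.hasSum).prod_fiberwise fun j => ?_
  refine (expand B A j).congr_fun ?_ |> fun h => h
  intro i
  simp [F, mul_comm]

/-- `Tr (Q M) = ∑ᵢ ‖Q √M eᵢ‖²` for a positive trace-class `M` and an orthogonal projection `Q`. -/
theorem hasSum_inner_proj_mul {M Q : H →L[ℂ] H} (hM : 0 ≤ M) (hQ : IsStarProjection Q)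
    (h : hilbertSchmidtSq (CFC.sqrt M) ≠ ⊤) :
    HasSum (fun i => ⟪basis H i, (Q * M) (basis H i)⟫_ℂ)
      (((hilbertSchmidtSq (Q * CFC.sqrt M)).toReal : ℝ) : ℂ) := by
  have hQ1 : ‖Q‖ ≤ 1 := hQ.norm_le
  have hQT := ne_top_of_le_ne_top h (hilbertSchmidtSq_mul_le Q _ hQ1)
  obtain ⟨s, h1, h2⟩ := exists_hasSum_inner_mul_comm hQT h
  rw [mul_assoc, CFC.sqrt_mul_sqrt_self M hM] at h1
  have hT : IsSelfAdjoint (CFC.sqrt M) := (CFC.sqrt_nonneg M).isSelfAdjoint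
  have e : ∀ x : H, ⟪x, (CFC.sqrt M * (Q * CFC.sqrt M)) x⟫_ℂ =
      ((‖(Q * CFC.sqrt M) x‖ ^ 2 : ℝ) : ℂ) := fun x => by
    have e1 : CFC.sqrt M * (Q * CFC.sqrt M) = star (Q * CFC.sqrt M) * (Q * CFC.sqrt M) := by
      rw [star_mul, hT.star_eq, hQ.isSelfAdjoint.star_eq, mul_assoc, ← mul_assoc Q Q,
        hQ.isIdempotentElem.eq]
    rw [e1, mul_apply_eq_comp, ContinuousLinearMap.star_eq_adjoint,
      ContinuousLinearMap.adjoint_inner_right, inner_self_eq_norm_sq_to_K]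
    norm_cast
  simp_rw [e] at h2
  have h3 : HasSum (fun i => ‖(Q * CFC.sqrt M) (basis H i)‖ ^ 2)
      (hilbertSchmidtSq (Q * CFC.sqrt M)).toReal := by
    have := ENNReal.hasSum_toReal hQT
    rw [← ENNReal.tsum_toReal_eq fun i => ENNReal.ofReal_ne_top] at this
    simp only [ENNReal.toReal_ofReal (sq_nonneg _)] at this
    exact this
  rw [((Complex.hasSum_ofReal.2 h3).unique h2)]
  exact h1

theorem summable_re_of_le {A B : H →L[ℂ] H} (hA : 0 ≤ A) (h : A ≤ B)
    (hs : Summable fun i => (⟪basis H i, B (basis H i)⟫_ℂ).re) :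
    Summable fun i => (⟪basis H i, A (basis H i)⟫_ℂ).re :=
  hs.of_nonneg_of_le (fun _ => re_inner_nonneg A hA _) fun _ => re_inner_mono h _

theorem hilbertSchmidtSq_sqrt_ne_top {M : H →L[ℂ] H} (hM : 0 ≤ M)
    (hs : Summable fun i => (⟪basis H i, M (basis H i)⟫_ℂ).re) :
    hilbertSchmidtSq (CFC.sqrt M) ≠ ⊤ := by
  simp_rw [hilbertSchmidtSq, ← re_inner_eq_norm_sqrt M hM]
  rw [← ENNReal.ofReal_tsum_of_nonneg (fun _ => re_inner_nonneg M hM _) hs]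
  exact ENNReal.ofReal_ne_top

theorem isTraceClass_of_nonneg {M : H →L[ℂ] H} (hM : 0 ≤ M)
    (hs : Summable fun i => (⟪basis H i, M (basis H i)⟫_ℂ).re) : IsTraceClass M := by
  refine isTraceClass_of_le M M hM.isSelfAdjoint hM le_rfl ?_ hs
  exact (neg_nonpos.2 hM).trans hM

variable (H) in
/-- The positive operators of finite trace. -/
def positiveTraceClass : Set (H →L[ℂ] H) :=
  {M | 0 ≤ M ∧ hilbertSchmidtSq (CFC.sqrt M) ≠ ⊤}

theorem posPart_mem_positiveTraceClass (γ : selfAdjointTraceClass H) :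
    (γ : H →L[ℂ] H)⁺ ∈ positiveTraceClass H := by
  refine ⟨CFC.posPart_nonneg _, hilbertSchmidtSq_sqrt_ne_top (CFC.posPart_nonneg _) ?_⟩
  refine summable_re_of_le (CFC.posPart_nonneg _) ?_ γ.2.2.summable_re
  rw [← CFC.posPart_add_negPart _ γ.2.1]
  exact le_add_of_nonneg_right (CFC.negPart_nonneg _)

theorem negPart_mem_positiveTraceClass (γ : selfAdjointTraceClass H) :
    (γ : H →L[ℂ] H)⁻ ∈ positiveTraceClass H := by
  refine ⟨CFC.negPart_nonneg _, hilbertSchmidtSq_sqrt_ne_top (CFC.negPart_nonneg _) ?_⟩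
  refine summable_re_of_le (CFC.negPart_nonneg _) ?_ γ.2.2.summable_re
  rw [← CFC.posPart_add_negPart _ γ.2.1]
  exact le_add_of_nonneg_left (CFC.posPart_nonneg _)

theorem mem_selfAdjointTraceClass_of_positive {M : H →L[ℂ] H} (hM : M ∈ positiveTraceClass H) :
    M ∈ selfAdjointTraceClass H := by
  refine ⟨hM.1.isSelfAdjoint, isTraceClass_of_nonneg hM.1 ?_⟩
  refine (ENNReal.summable_toReal hM.2).congr fun i => ?_
  rw [ENNReal.toReal_ofReal (sq_nonneg _), re_inner_eq_norm_sqrt M hM.1]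

theorem mem_positiveTraceClass_of_isPositive {γ : selfAdjointTraceClass H}
    (h : (γ : H →L[ℂ] H).IsPositive) : (γ : H →L[ℂ] H) ∈ positiveTraceClass H := by
  have h0 := (ContinuousLinearMap.nonneg_iff_isPositive _).2 h
  refine ⟨h0, hilbertSchmidtSq_sqrt_ne_top h0 ?_⟩
  exact summable_re_of_le h0 (le_abs γ.2.1) γ.2.2.summable_re

theorem trace_proj_mul_of_positive {M Q : H →L[ℂ] H} (hM : M ∈ positiveTraceClass H)
    (hQ : IsStarProjection Q) :
    trace (Q * M) = (((hilbertSchmidtSq (Q * CFC.sqrt M)).toReal : ℝ) : ℂ) :=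
  (hasSum_inner_proj_mul hM.1 hQ hM.2).tsum_eq

theorem summable_inner_proj_mul (γ : selfAdjointTraceClass H) {Q : H →L[ℂ] H}
    (hQ : IsStarProjection Q) :
    Summable fun i => ⟪basis H i, (Q * (γ : H →L[ℂ] H)) (basis H i)⟫_ℂ := by
  have hp := posPart_mem_positiveTraceClass γ
  have hn := negPart_mem_positiveTraceClass γ
  refine ((hasSum_inner_proj_mul hp.1 hQ hp.2).summable.sub
    (hasSum_inner_proj_mul hn.1 hQ hn.2).summable).congr fun i => ?_
  rw [← inner_sub_right, ← sub_apply, ← mul_sub, CFC.posPart_sub_negPart _ γ.2.1]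

theorem trace_proj_mul_add (γ γ' : selfAdjointTraceClass H) {Q : H →L[ℂ] H}
    (hQ : IsStarProjection Q) :
    trace (Q * ((γ + γ' : selfAdjointTraceClass H) : H →L[ℂ] H)) =
      trace (Q * (γ : H →L[ℂ] H)) + trace (Q * (γ' : H →L[ℂ] H)) := by
  rw [trace, trace, trace,
    ← (summable_inner_proj_mul γ hQ).tsum_add (summable_inner_proj_mul γ' hQ)]
  refine tsum_congr fun i => ?_
  rw [← inner_add_right, ← add_apply, ← mul_add, Submodule.coe_add]

theorem trace_proj_mul_smul (c : ℝ) (γ : selfAdjointTraceClass H) {Q : H →L[ℂ] H} :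
    trace (Q * ((c • γ : selfAdjointTraceClass H) : H →L[ℂ] H)) =
      c * trace (Q * (γ : H →L[ℂ] H)) := by
  rw [trace, trace, ← tsum_mul_left]
  refine tsum_congr fun i => ?_
  rw [Submodule.coe_smul, mul_smul_comm, smul_apply, inner_smul_right_eq_smul, Complex.real_smul]

/-- A family of vectors with summable squared norms gives the positive trace-class operator
`∑ᵢ |zᵢ⟩⟨zᵢ|`. -/
theorem exists_positive_trace_eq {ι : Type*} (z : ι → H)
    (hz : ∑' i, ENNReal.ofReal (‖z i‖ ^ 2) ≠ ⊤) :
    ∃ M ∈ positiveTraceClass H, ∀ Q : H →L[ℂ] H, IsStarProjection Q →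
      hilbertSchmidtSq (Q * CFC.sqrt M) = ∑' i, ENNReal.ofReal (‖Q (z i)‖ ^ 2) := by
  have hz' : Summable fun i => ‖z i‖ ^ 2 := by
    refine (ENNReal.summable_toReal hz).congr fun i => ?_
    rw [ENNReal.toReal_ofReal (sq_nonneg _)]
  have hs : Summable fun i => InnerProductSpace.rankOne ℂ (z i) (z i) := by
    refine .of_norm ?_
    simpa [pow_two] using hz'
  obtain ⟨M, hM⟩ := hs
  have hin : ∀ x : H, HasSum (fun i => ⟪x, InnerProductSpace.rankOne ℂ (z i) (z i) x⟫_ℂ) ⟪x, M x⟫_ℂ :=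
    fun x => (hM.mapL (ContinuousLinearMap.apply ℂ H x)).mapL (innerSL ℂ x)
  have hre : ∀ x : H, HasSum (fun i => ‖⟪x, z i⟫_ℂ‖ ^ 2) (⟪x, M x⟫_ℂ).re := fun x => by
    refine (Complex.hasSum_re (hin x)).congr_fun ?_ |> fun h => h
    intro i
    rw [InnerProductSpace.rankOne_apply, inner_smul_right, ← inner_conj_symm (z i), RCLike.conj_mul]
    norm_cast
  have h0 : 0 ≤ M := by
    refine (isClosed_Ici (a := (0 : H →L[ℂ] H))).mem_of_tendsto hM (.of_forall fun s => ?_)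
    exact Finset.sum_nonneg fun i _ => (ContinuousLinearMap.nonneg_iff_isPositive _).2
      (InnerProductSpace.isPositive_rankOne_self (z i))
  have hT : IsSelfAdjoint (CFC.sqrt M) := (CFC.sqrt_nonneg M).isSelfAdjoint
  have main : ∀ Q : H →L[ℂ] H, IsStarProjection Q →
      hilbertSchmidtSq (Q * CFC.sqrt M) = ∑' i, ENNReal.ofReal (‖Q (z i)‖ ^ 2) := by
    intro Q hQ
    have hQ' : ContinuousLinearMap.adjoint Q = Q := hQ.isSelfAdjoint.star_eq
    rw [hilbertSchmidtSq, tsum_adjoint, ← ContinuousLinearMap.star_eq_adjoint, star_mul,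
      hT.star_eq, hQ.isSelfAdjoint.star_eq]
    simp_rw [enorm_sq_eq_tsum (Q _), mul_apply_eq_comp, ← re_inner_eq_norm_sqrt M h0]
    rw [ENNReal.tsum_comm]
    refine tsum_congr fun j => ?_
    rw [← (hre _).tsum_eq, ENNReal.ofReal_tsum_of_nonneg (fun _ => sq_nonneg _) (hre _).summable]
    refine tsum_congr fun i => ?_
    rw [← ContinuousLinearMap.adjoint_inner_left, hQ']
  refine ⟨M, ⟨h0, ?_⟩, main⟩
  have h1 := main 1 (.one _)
  rw [one_mul] at h1
  rw [h1]
  simpa using hz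

end Trace

section VectorMeasure

variable {Ω H : Type*} [MeasurableSpace Ω] [NormedAddCommGroup H] [InnerProductSpace ℂ H]
  [CompleteSpace H]

set_option linter.unusedSectionVars false in
theorem inner_starProjection_eq {Q : H →L[ℂ] H} (hQ : IsStarProjection Q) (x : H) :
    ⟪x, Q x⟫_ℂ = ((‖Q x‖ ^ 2 : ℝ) : ℂ) := by
  have h1 : ContinuousLinearMap.adjoint Q = Q := hQ.isSelfAdjoint.star_eq
  have h2 : Q (Q x) = Q x := congrArg (fun A : H →L[ℂ] H => A x) hQ.isIdempotentElem.eq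
  rw [← h2, ← ContinuousLinearMap.adjoint_inner_left, h1, h2, inner_self_eq_norm_sq_to_K]
  norm_cast

namespace ProjectionValuedMeasure

variable (P : ProjectionValuedMeasure Ω H)

theorem tsum_norm_sq (x : H) {S : ℕ → Set Ω} (hS : ∀ i, MeasurableSet (S i))
    (hd : Pairwise (fun i j => Disjoint (S i) (S j))) :
    ENNReal.ofReal (‖P.toFun (⋃ i, S i) x‖ ^ 2) =
      ∑' i, ENNReal.ofReal (‖P.toFun (S i) x‖ ^ 2) := by
  have h := (P.hasSum_iUnion S hS hd x).mapL (innerSL ℂ x)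
  simp only [innerSL_apply_apply] at h
  rw [inner_starProjection_eq (P.isStarProjection _ (.iUnion hS))] at h
  simp_rw [fun i => inner_starProjection_eq (P.isStarProjection _ (hS i)) x] at h
  have h2 := Complex.hasSum_ofReal.1 h
  rw [← h2.tsum_eq, ENNReal.ofReal_tsum_of_nonneg (fun _ => sq_nonneg _) h2.summable]

/-- The measure `S ↦ ‖P(S) x‖²`. -/
noncomputable def vecMeasure (x : H) : Measure Ω :=
  Measure.ofMeasurable (fun S _ => ENNReal.ofReal (‖P.toFun S x‖ ^ 2))
    (by simp [P.empty]) (fun _ hS hd => P.tsum_norm_sq x hS hd)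

theorem vecMeasure_apply (x : H) {S : Set Ω} (hS : MeasurableSet S) :
    P.vecMeasure x S = ENNReal.ofReal (‖P.toFun S x‖ ^ 2) :=
  Measure.ofMeasurable_apply S hS

theorem vecMeasure_univ (x : H) : P.vecMeasure x Set.univ = ENNReal.ofReal (‖x‖ ^ 2) := by
  rw [P.vecMeasure_apply x .univ, P.univ]; simp

instance (x : H) : IsFiniteMeasure (P.vecMeasure x) :=
  ⟨by rw [vecMeasure_univ]; exact ENNReal.ofReal_lt_top⟩

theorem vecMeasure_absolutelyContinuous {μ : Measure Ω} (hP : P.AbsolutelyContinuous μ) (x : H) :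
    P.vecMeasure x ≪ μ :=
  .mk fun S hS h => by rw [P.vecMeasure_apply x hS, hP S hS h]; simp

theorem vecMeasure_smul (c : ℝ) (x : H) :
    P.vecMeasure (c • x) = ENNReal.ofReal (c ^ 2) • P.vecMeasure x := by
  ext S hS
  rw [Measure.smul_apply, P.vecMeasure_apply _ hS, P.vecMeasure_apply _ hS, smul_eq_mul,
    ← ENNReal.ofReal_mul (sq_nonneg _), (P.toFun S).map_smul_of_tower, norm_smul, mul_pow,
    Real.norm_eq_abs, sq_abs]

theorem vecMeasure_toFun (x : H) {E : Set Ω} (hE : MeasurableSet E) :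
    P.vecMeasure (P.toFun E x) = (P.vecMeasure x).restrict E := by
  ext S hS
  rw [Measure.restrict_apply hS, P.vecMeasure_apply _ hS, P.vecMeasure_apply _ (hS.inter hE),
    P.inter S E hS hE, mul_apply_eq_comp]

theorem vecMeasure_ne_zero {x : H} (hx : x ≠ 0) : P.vecMeasure x ≠ 0 := by
  intro h
  have h1 := P.vecMeasure_univ x
  rw [h] at h1
  have h2 : ‖x‖ ^ 2 ≤ 0 := ENNReal.ofReal_eq_zero.1 h1.symm
  exact hx (norm_eq_zero.1 (pow_eq_zero_iff two_ne_zero |>.1 (le_antisymm h2 (sq_nonneg _))))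

theorem sum_vecMeasure_apply (T : H →L[ℂ] H) {S : Set Ω} (hS : MeasurableSet S) :
    Measure.sum (fun i => P.vecMeasure (T (basis H i))) S = hilbertSchmidtSq (P.toFun S * T) := by
  rw [Measure.sum_apply _ hS]
  exact tsum_congr fun i => P.vecMeasure_apply _ hS

/-- If `P` is faithful, every nonzero finite measure `σ ≪ μ` dominates some nonzero
`S ↦ ‖P(S) z‖²`. -/
theorem exists_vecMeasure_le {μ : Measure Ω} [SigmaFinite μ] (hP : P.AbsolutelyContinuous μ)
    (hf : P.Faithful μ) {σ : Measure Ω} [IsFiniteMeasure σ] (hσ : σ ≪ μ) (h0 : σ ≠ 0) :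
    ∃ z : H, z ≠ 0 ∧ P.vecMeasure z ≤ σ := by
  let E : Set Ω := {ω | σ.rnDeriv μ ω ≠ 0}
  have hE : MeasurableSet E := (Measure.measurable_rnDeriv σ μ) (measurableSet_singleton 0).compl
  have hσE : μ.withDensity (σ.rnDeriv μ) = σ := Measure.withDensity_rnDeriv_eq σ μ hσ
  have hEσ : μ.restrict E ≪ σ := by
    have h1 : μ.restrict E ≪ (μ.restrict E).withDensity (σ.rnDeriv μ) :=
      withDensity_absolutelyContinuous' (Measure.measurable_rnDeriv σ μ).aemeasurable
        ((ae_restrict_iff' hE).2 (.of_forall fun _ h => h))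
    refine h1.trans ?_
    rw [← restrict_withDensity hE, hσE]
    exact Measure.restrict_le_self.absolutelyContinuous
  have hμE : μ E ≠ 0 := by
    intro h
    refine h0 ?_
    rw [← hσE]
    refine (withDensity_eq_zero_iff (Measure.measurable_rnDeriv σ μ).aemeasurable).2 ?_
    exact measure_eq_zero_iff_ae_notMem.1 h |>.mono fun ω hω => by simpa [E] using hω
  have hPE : P.toFun E ≠ 0 := fun h => hμE (hf E hE h)
  obtain ⟨x, hx⟩ : ∃ x, P.toFun E x ≠ 0 := by
    by_contra! h
    exact hPE (ContinuousLinearMap.ext h)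
  have hac : P.vecMeasure (P.toFun E x) ≪ σ := by
    rw [P.vecMeasure_toFun x hE]
    exact ((P.vecMeasure_absolutelyContinuous hP x).restrict E).trans hEσ
  have hns : ¬ σ ⟂ₘ P.vecMeasure (P.toFun E x) := fun h =>
    P.vecMeasure_ne_zero hx (Measure.eq_zero_of_absolutelyContinuous_of_mutuallySingular hac h.symm)
  obtain ⟨ε, hε, F, hF, hFpos, hle⟩ := Measure.exists_positive_of_not_mutuallySingular _ _ hns
  refine ⟨Real.sqrt ε • P.toFun F (P.toFun E x), ?_, ?_⟩
  · refine smul_ne_zero (Real.sqrt_pos.2 hε).ne' fun h => ?_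
    rw [P.vecMeasure_apply _ hF, h] at hFpos
    simp at hFpos
  · rw [P.vecMeasure_smul, Real.sq_sqrt ε.coe_nonneg, P.vecMeasure_toFun _ hF]
    refine Measure.le_iff.2 fun A hA => ?_
    rw [Measure.smul_apply, Measure.restrict_apply hA, smul_eq_mul, ENNReal.ofReal_coe_nnreal]
    exact (hle A hA).trans (measure_mono Set.inter_subset_left)

theorem exists_vecMeasure_le_notMem {μ : Measure Ω} [SigmaFinite μ]
    (hP : P.AbsolutelyContinuous μ) (hf : P.Faithful μ) {σ : Measure Ω} [IsFiniteMeasure σ]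
    (hσ : σ ≪ μ) (h0 : σ ≠ 0) {Z : Set H} (hZ : Z.Countable) :
    ∃ z ∉ Z, P.vecMeasure z ≤ σ := by
  obtain ⟨z, hz, hle⟩ := P.exists_vecMeasure_le hP hf hσ h0
  by_contra! h
  have hinj : Function.Injective fun t : ℝ => t • z := smul_left_injective ℝ hz
  have hc : (Set.Ioc (0 : ℝ) 1).Countable := by
    refine (hZ.preimage hinj).mono fun t ht => ?_
    by_contra hn
    refine h _ hn (le_trans ?_ hle)
    rw [P.vecMeasure_smul]
    refine Measure.le_iff.2 fun A _ => ?_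
    rw [Measure.smul_apply, smul_eq_mul]
    refine mul_le_of_le_one_left zero_le ?_
    rw [ENNReal.ofReal_le_one]
    exact pow_le_one₀ ht.1.le ht.2
  rw [Cardinal.Real.Ioc_countable_iff] at hc
  linarith

theorem sum_vecMeasure_le {Z : Set H} {τ : Measure Ω}
    (hZ : ∀ F : Finset H, (F : Set H) ⊆ Z → ∑ z ∈ F, P.vecMeasure z ≤ τ) :
    Measure.sum (fun z : Z => P.vecMeasure z) ≤ τ := by
  refine Measure.le_iff.2 fun A hA => ?_
  rw [Measure.sum_apply _ hA, ENNReal.tsum_eq_iSup_sum]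
  refine iSup_le fun F => ?_
  have h := Measure.le_iff.1 (hZ (F.map (Function.Embedding.subtype _)) (by simp)) A hA
  rw [Finset.sum_map, Measure.finsetSum_apply] at h
  exact h

/-- If `P` is faithful, every finite measure `τ ≪ μ` is a sum of measures `S ↦ ‖P(S) z‖²`. -/
theorem exists_sum_vecMeasure_eq {μ : Measure Ω} [SigmaFinite μ] (hP : P.AbsolutelyContinuous μ)
    (hf : P.Faithful μ) {τ : Measure Ω} [IsFiniteMeasure τ] (hτ : τ ≪ μ) :
    ∃ Z : Set H, Measure.sum (fun z : Z => P.vecMeasure z) = τ := by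
  obtain ⟨Z, hZ⟩ := zorn_subset
    {Z : Set H | ∀ F : Finset H, (F : Set H) ⊆ Z → ∑ z ∈ F, P.vecMeasure z ≤ τ} (by
      intro c hc hchain
      rcases c.eq_empty_or_nonempty with rfl | hne
      · refine ⟨∅, fun F hF => ?_, by simp⟩
        rw [Set.subset_empty_iff, Finset.coe_eq_empty] at hF
        rw [hF, Finset.sum_empty]
        exact Measure.zero_le _
      · refine ⟨⋃₀ c, fun F hF => ?_, fun s hs => Set.subset_sUnion_of_mem hs⟩
        obtain ⟨t, ht, hFt⟩ := DirectedOn.exists_mem_subset_of_finite_of_subset_sUnion hne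
          hchain.directedOn F.finite_toSet hF
        exact hc ht F hFt)
  refine ⟨Z, ?_⟩
  have hle := P.sum_vecMeasure_le hZ.prop
  by_contra hne
  have : IsFiniteMeasure (Measure.sum fun z : Z => P.vecMeasure z) := isFiniteMeasure_of_le τ hle
  set ν := Measure.sum fun z : Z => P.vecMeasure z with hν
  have hadd : τ - ν + ν = τ := Measure.sub_add_cancel_of_le hle
  have h0 : τ - ν ≠ 0 := fun h => hne (by rw [← hadd, h, zero_add])
  have hcount : (Z ∪ {0}).Countable := by
    have h1 : ∑' z : Z, ENNReal.ofReal (‖(z : H)‖ ^ 2) ≠ ⊤ := by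
      have h2 := measure_ne_top ν Set.univ
      rw [hν, Measure.sum_apply _ .univ] at h2
      simpa only [P.vecMeasure_univ] using h2
    have h3 := (Summable.countable_support_ennreal h1).image ((↑) : Z → H)
    refine (h3.union (Set.countable_singleton (0 : H))).mono fun z hz => ?_
    rcases eq_or_ne z 0 with rfl | h
    · exact Or.inr rfl
    · refine Or.inl ⟨⟨z, hz.resolve_right h⟩, ?_, rfl⟩
      simp [h]
  obtain ⟨z, hzZ, hzle⟩ := P.exists_vecMeasure_le_notMem hP hf
    ((Measure.sub_le.absolutelyContinuous).trans hτ) h0 hcount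
  have hzZ' : z ∉ Z := fun h => hzZ (Or.inl h)
  refine hzZ' (hZ.le_of_ge (y := insert z Z) ?_ (Set.subset_insert _ _) (Set.mem_insert _ _))
  intro F hF
  classical
  have hsub : ((F.erase z : Finset H) : Set H) ⊆ Z := fun y hy => by
    rw [Finset.coe_erase] at hy
    exact (hF hy.1).resolve_left hy.2
  have hF' : ∑ y ∈ F.erase z, P.vecMeasure y ≤ ν := by
    refine Measure.le_iff.2 fun A hA => ?_
    rw [hν, Measure.sum_apply _ hA, Measure.finsetSum_apply]
    rw [← Finset.sum_subtype_of_mem (p := (· ∈ Z)) (fun y => P.vecMeasure y A) hsub]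
    exact ENNReal.sum_le_tsum _
  calc ∑ y ∈ F, P.vecMeasure y ≤ P.vecMeasure z + ∑ y ∈ F.erase z, P.vecMeasure y := by
        by_cases hz : z ∈ F
        · rw [Finset.add_sum_erase _ _ hz]
        · rw [Finset.erase_eq_of_notMem hz]
          exact Measure.le_add_left le_rfl
    _ ≤ τ - ν + ν := add_le_add hzle hF'
    _ = τ := hadd

end ProjectionValuedMeasure

end VectorMeasure

section Diagonal

variable {Ω H : Type*} [MeasurableSpace Ω] [NormedAddCommGroup H] [InnerProductSpace ℂ H]
  [CompleteSpace H] (P : ProjectionValuedMeasure Ω H) {μ : Measure Ω}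

theorem ProjectionValuedMeasure.isFiniteMeasure_sum {M : H →L[ℂ] H}
    (hM : M ∈ positiveTraceClass H) :
    IsFiniteMeasure (Measure.sum fun i => P.vecMeasure (CFC.sqrt M (basis H i))) := by
  refine ⟨?_⟩
  rw [P.sum_vecMeasure_apply _ .univ, P.univ, one_mul]
  exact lt_top_iff_ne_top.2 hM.2

theorem ProjectionValuedMeasure.exists_signedMeasure_of_positive {M : H →L[ℂ] H}
    (hM : M ∈ positiveTraceClass H) :
    ∃ ν : SignedMeasure Ω, ∀ S, MeasurableSet S → ((ν S : ℝ) : ℂ) = trace (P.toFun S * M) := by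
  have := P.isFiniteMeasure_sum hM
  refine ⟨(Measure.sum fun i => P.vecMeasure (CFC.sqrt M (basis H i))).toSignedMeasure,
    fun S hS => ?_⟩
  rw [Measure.toSignedMeasure_apply_measurable hS, Measure.real, P.sum_vecMeasure_apply _ hS,
    trace_proj_mul_of_positive hM (P.isStarProjection S hS)]

/-- The decomposition of a self-adjoint trace-class operator in its positive and negative parts. -/
theorem exists_positive_sub (γ : selfAdjointTraceClass H) :
    ∃ γ₁ γ₂ : selfAdjointTraceClass H, (γ₁ : H →L[ℂ] H) ∈ positiveTraceClass H ∧
      (γ₂ : H →L[ℂ] H) ∈ positiveTraceClass H ∧ γ₁ = γ + γ₂ ∧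
      CFC.abs (γ : H →L[ℂ] H) = ((γ₁ + γ₂ : selfAdjointTraceClass H) : H →L[ℂ] H) := by
  have hp := posPart_mem_positiveTraceClass γ
  have hn := negPart_mem_positiveTraceClass γ
  refine ⟨⟨_, mem_selfAdjointTraceClass_of_positive hp⟩,
    ⟨_, mem_selfAdjointTraceClass_of_positive hn⟩, hp, hn, Subtype.ext ?_, ?_⟩
  · exact sub_eq_iff_eq_add.1 (CFC.posPart_sub_negPart _ γ.2.1)
  · exact (CFC.posPart_add_negPart _ γ.2.1).symm

theorem ProjectionValuedMeasure.exists_signedMeasure (γ : selfAdjointTraceClass H) :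
    ∃ ν : SignedMeasure Ω, ∀ S, MeasurableSet S →
      ((ν S : ℝ) : ℂ) = trace (P.toFun S * (γ : H →L[ℂ] H)) := by
  obtain ⟨γ₁, γ₂, h1, h2, h, -⟩ := exists_positive_sub γ
  obtain ⟨ν₁, hν₁⟩ := P.exists_signedMeasure_of_positive h1
  obtain ⟨ν₂, hν₂⟩ := P.exists_signedMeasure_of_positive h2
  refine ⟨ν₁ - ν₂, fun S hS => ?_⟩
  rw [_root_.sub_apply, Complex.ofReal_sub, hν₁ S hS, hν₂ S hS, h,
    trace_proj_mul_add _ _ (P.isStarProjection S hS), add_sub_cancel_right]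

variable {P}

theorem exists_isRadonNikodymDerivative (hP : P.AbsolutelyContinuous μ)
    (γ : selfAdjointTraceClass H) :
    ∃ ρ : Lp ℝ 1 μ, IsRadonNikodymDerivative P μ (γ : H →L[ℂ] H) ρ := by
  obtain ⟨ν, hν⟩ := P.exists_signedMeasure γ
  have hi := SignedMeasure.integrable_rnDeriv ν μ
  refine ⟨hi.toL1 _, ν, hν, .mk fun S hS h => ?_, hi.coeFn_toL1⟩
  rw [Measure.toENNRealVectorMeasure_apply_measurable hS] at h
  have h1 := hν S hS
  rw [hP S hS h, zero_mul] at h1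
  simpa [trace] using h1

theorem IsRadonNikodymDerivative.trace_eq_setIntegral [SigmaFinite μ] {γ : H →L[ℂ] H}
    {ρ : Lp ℝ 1 μ} (h : IsRadonNikodymDerivative P μ γ ρ) {S : Set Ω} (hS : MeasurableSet S) :
    trace (P.toFun S * γ) = ((∫ x in S, ρ x ∂μ : ℝ) : ℂ) := by
  obtain ⟨ν, hν, hac, hρ⟩ := h
  rw [← hν S hS, integral_congr_ae (ae_restrict_of_ae hρ),
    ← withDensityᵥ_apply (SignedMeasure.integrable_rnDeriv ν μ) hS,
    SignedMeasure.withDensityᵥ_rnDeriv_eq ν μ hac]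

theorem Lp_one_ext_setIntegral {f g : Lp ℝ 1 μ}
    (h : ∀ S, MeasurableSet S → ∫ x in S, f x ∂μ = ∫ x in S, g x ∂μ) : f = g :=
  Lp.ext (Integrable.ae_eq_of_forall_setIntegral_eq _ _ (L1.integrable_coeFn f)
    (L1.integrable_coeFn g) fun S hS _ => h S hS)

theorem setIntegral_Lp_one_add (f g : Lp ℝ 1 μ) (S : Set Ω) :
    ∫ x in S, (f + g) x ∂μ = ∫ x in S, f x ∂μ + ∫ x in S, g x ∂μ := by
  rw [← integral_add (L1.integrable_coeFn f).integrableOn (L1.integrable_coeFn g).integrableOn]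
  exact integral_congr_ae (ae_restrict_of_ae (Lp.coeFn_add f g))

theorem setIntegral_Lp_one_smul (c : ℝ) (f : Lp ℝ 1 μ) (S : Set Ω) :
    ∫ x in S, (c • f) x ∂μ = c * ∫ x in S, f x ∂μ := by
  rw [← integral_const_mul]
  exact integral_congr_ae (ae_restrict_of_ae (Lp.coeFn_smul c f))

theorem exists_linearMap_isRadonNikodymDerivative [SigmaFinite μ]
    (hP : P.AbsolutelyContinuous μ) :
    ∃ D : selfAdjointTraceClass H →ₗ[ℝ] Lp ℝ 1 μ, ∀ γ : selfAdjointTraceClass H,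
      IsRadonNikodymDerivative P μ (γ : H →L[ℂ] H) (D γ) := by
  choose D hD using fun γ : selfAdjointTraceClass H => exists_isRadonNikodymDerivative hP γ
  refine ⟨{ toFun := D, map_add' := fun γ γ' => ?_, map_smul' := fun c γ => ?_ }, hD⟩
  · refine Lp_one_ext_setIntegral fun S hS => Complex.ofReal_injective ?_
    rw [setIntegral_Lp_one_add, Complex.ofReal_add, ← (hD _).trace_eq_setIntegral hS,
      ← (hD _).trace_eq_setIntegral hS, ← (hD _).trace_eq_setIntegral hS,
      trace_proj_mul_add _ _ (P.isStarProjection S hS)]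
  · refine Lp_one_ext_setIntegral fun S hS => Complex.ofReal_injective ?_
    rw [RingHom.id_apply, setIntegral_Lp_one_smul, Complex.ofReal_mul,
      ← (hD _).trace_eq_setIntegral hS, ← (hD _).trace_eq_setIntegral hS, trace_proj_mul_smul]

variable {D : selfAdjointTraceClass H →ₗ[ℝ] Lp ℝ 1 μ}

theorem ae_nonneg_of_mem_positiveTraceClass [SigmaFinite μ] {M : H →L[ℂ] H} {ρ : Lp ℝ 1 μ}
    (hM : M ∈ positiveTraceClass H) (h : IsRadonNikodymDerivative P μ M ρ) : 0 ≤ᵐ[μ] ρ := by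
  refine ae_nonneg_of_forall_setIntegral_nonneg (L1.integrable_coeFn ρ) fun S hS _ => ?_
  have h1 := h.trace_eq_setIntegral hS
  rw [trace_proj_mul_of_positive hM (P.isStarProjection S hS), Complex.ofReal_inj] at h1
  rw [← h1]
  exact ENNReal.toReal_nonneg

theorem norm_Lp_one_eq_integral {f : Lp ℝ 1 μ} (hf : 0 ≤ᵐ[μ] f) : ‖f‖ = ∫ x, f x ∂μ := by
  rw [L1.norm_eq_integral_norm]
  exact integral_congr_ae (hf.mono fun x hx => Real.norm_of_nonneg hx)

theorem isDiagonalMap_of_isRadonNikodymDerivative [SigmaFinite μ]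
    (hD : ∀ γ : selfAdjointTraceClass H, IsRadonNikodymDerivative P μ (γ : H →L[ℂ] H) (D γ)) :
    IsDiagonalMap P μ D where
  norm_le γ := by
    obtain ⟨γ₁, γ₂, h1, h2, h, habs⟩ := exists_positive_sub γ
    have hn1 := norm_Lp_one_eq_integral (ae_nonneg_of_mem_positiveTraceClass h1 (hD γ₁))
    have hn2 := norm_Lp_one_eq_integral (ae_nonneg_of_mem_positiveTraceClass h2 (hD γ₂))
    have ht := (hD (γ₁ + γ₂)).trace_eq_setIntegral .univ
    rw [P.univ, one_mul, ← habs, map_add, setIntegral_Lp_one_add, setIntegral_univ,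
      setIntegral_univ, ← hn1, ← hn2] at ht
    rw [traceNorm, ht, Complex.ofReal_re, eq_sub_of_add_eq h.symm, map_sub]
    exact norm_sub_le _ _
  nonneg γ hγ :=
    ae_nonneg_of_mem_positiveTraceClass (mem_positiveTraceClass_of_isPositive hγ) (hD γ)
  trace_eq γ := by
    simpa [P.univ] using (hD γ).trace_eq_setIntegral MeasurableSet.univ
  trace_mul_eq γ _ hS := (hD γ).trace_eq_setIntegral hS

theorem IsDiagonalMap.unique {D' : selfAdjointTraceClass H →ₗ[ℝ] Lp ℝ 1 μ}
    (h' : IsDiagonalMap P μ D') (h : IsDiagonalMap P μ D) : D' = D :=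
  LinearMap.ext fun γ => Lp_one_ext_setIntegral fun S hS => Complex.ofReal_injective <| by
    rw [← h'.trace_mul_eq γ S hS, ← h.trace_mul_eq γ S hS]

theorem exists_trace_eq_measure [SigmaFinite μ] (hP : P.AbsolutelyContinuous μ)
    (hf : P.Faithful μ) {τ : Measure Ω} [IsFiniteMeasure τ] (hτ : τ ≪ μ) :
    ∃ γ : selfAdjointTraceClass H, ∀ S, MeasurableSet S →
      trace (P.toFun S * (γ : H →L[ℂ] H)) = (((τ S).toReal : ℝ) : ℂ) := by
  obtain ⟨Z, hZ⟩ := P.exists_sum_vecMeasure_eq hP hf hτ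
  have happ : ∀ S, MeasurableSet S →
      ∑' z : Z, ENNReal.ofReal (‖P.toFun S z‖ ^ 2) = τ S := fun S hS => by
    rw [← hZ, Measure.sum_apply _ hS]
    exact tsum_congr fun z => (P.vecMeasure_apply _ hS).symm
  obtain ⟨M, hM, hMQ⟩ := exists_positive_trace_eq (fun z : Z => (z : H)) (by
    have h := happ _ .univ
    simp only [P.univ, one_apply_eq_self] at h
    rw [h]
    exact measure_ne_top τ _)
  refine ⟨⟨M, mem_selfAdjointTraceClass_of_positive hM⟩, fun S hS => ?_⟩
  rw [trace_proj_mul_of_positive hM (P.isStarProjection S hS),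
    hMQ _ (P.isStarProjection S hS), happ S hS]

theorem IsDiagonalMap.surjective [SigmaFinite μ] (hD : IsDiagonalMap P μ D)
    (hP : P.AbsolutelyContinuous μ) (hf : P.Faithful μ) : Function.Surjective D := by
  intro f
  have hi := L1.integrable_coeFn f
  have key : ∀ g : Ω → ℝ, Integrable g μ → ∃ γ : selfAdjointTraceClass H,
      ∀ S, MeasurableSet S → ∫ x in S, D γ x ∂μ = (∫⁻ x in S, ENNReal.ofReal (g x) ∂μ).toReal := by
    intro g hg
    have : IsFiniteMeasure (μ.withDensity fun x => ENNReal.ofReal (g x)) :=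
      isFiniteMeasure_withDensity_ofReal hg.2
    obtain ⟨γ, hγ⟩ := exists_trace_eq_measure hP hf
      (withDensity_absolutelyContinuous μ fun x => ENNReal.ofReal (g x))
    refine ⟨γ, fun S hS => Complex.ofReal_injective ?_⟩
    rw [← hD.trace_mul_eq γ S hS, hγ S hS, withDensity_apply _ hS]
  obtain ⟨γ₁, h₁⟩ := key f hi
  obtain ⟨γ₂, h₂⟩ := key (fun x => -f x) hi.neg
  refine ⟨γ₁ - γ₂, ?_⟩
  rw [map_sub, sub_eq_iff_eq_add]
  refine Lp_one_ext_setIntegral fun S hS => ?_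
  rw [setIntegral_Lp_one_add, h₁ S hS, h₂ S hS,
    integral_eq_lintegral_pos_part_sub_lintegral_neg_part hi.integrableOn, sub_add_cancel]

end Diagonal

end DiagonalMap

theorem mainTheorem6 {Ω H : Type*} [MeasurableSpace Ω] (μ : MeasureTheory.Measure Ω)
    [MeasureTheory.SigmaFinite μ] [NormedAddCommGroup H] [InnerProductSpace ℂ H] [CompleteSpace H]
    (P : DiagonalMap.ProjectionValuedMeasure Ω H) (hP : P.AbsolutelyContinuous μ) :
    ∃ D : DiagonalMap.selfAdjointTraceClass H →ₗ[ℝ] MeasureTheory.Lp ℝ 1 μ,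
      (∀ γ : DiagonalMap.selfAdjointTraceClass H,
        DiagonalMap.IsRadonNikodymDerivative P μ (γ : H →L[ℂ] H) (D γ)) ∧
      DiagonalMap.IsDiagonalMap P μ D ∧
      (∀ D', DiagonalMap.IsDiagonalMap P μ D' → D' = D) ∧
      (P.Faithful μ → Function.Surjective D) := by
  obtain ⟨D, hD⟩ := DiagonalMap.exists_linearMap_isRadonNikodymDerivative hP
  have hd := DiagonalMap.isDiagonalMap_of_isRadonNikodymDerivative hD
  exact ⟨D, hD, hd, fun D' hD' => hD'.unique hd, hd.surjective hP⟩
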